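/- Let $\mathcal X,\mathcal Y$ be finite-dimensional real Hilbert spaces, let $\Theta$ be an open subset of a finite-dimensional Euclidean space $T$, and fix $y\in\mathcal Y$, an integer $Q\ge 1$ and $\nu>0$. Let $F:\mathcal X\times\mathcal Y\times\Theta\to\mathbb R$ and $G_1,\dots,G_Q:\mathcal X\times\mathcal Y\times\Theta\to(-\infty,+\infty]$ be such that, for every $\theta\in\Theta$, $F(\cdot,y,\theta)$ is $C^1$ with gradient $\nabla_1F(\cdot,y,\theta)$ and each $G_k(\cdot,y,\theta)$ is proper, closed and convex. For such $G$ put $$\mathrm{Prox}_{\nu QG_k}(x,y,\theta)=\operatorname*{argmin}_{z\in\mathcal X}\ \tfrac12\|z-x\|^2+\nu Q\,G_k(z,y,\theta).$$ Assume that $(x,\theta)\mapsto\nabla_1F(x,y,\theta)$ is locally Lipschitz on $\mathcal X\times\Theta$ and that each $\theta\mapsto\mathrm{Prox}_{\nu QG_k}(x,y,\theta)$ is locally Lipschitz on $\Theta$, locally uniformly in $x$. The Generalized Forward–Backward (GFB) iterates $a^{(\ell)}=(\xi^{(\ell)},z_1^{(\ell)},\dots,z_Q^{(\ell)})\in\mathcal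 A=\mathcal X^{1+Q}$, $x^{(\ell)}=\gamma(a^{(\ell)}):=\xi^{(\ell)}$, start at a point $a^{(0)}(y,\theta)$ that is locally Lipschitz in $\theta\in\Theta$, and satisfy $a^{(\ell+1)}=\psi(a^{(\ell)},y,\theta)$, where $\psi$ is defined by $$x^{(\ell+1)}=\frac1Q\sum_{k=1}^Qz_k^{(\ell+1)},\qquad z_k^{(\ell+1)}=z_k^{(\ell)}-x^{(\ell)}+\mathrm{Prox}_{\nu QG_k}(Z_k^{(\ell)},y,\theta),\qquad Z_k^{(\ell)}=2x^{(\ell)}-z_k^{(\ell)}-\nu\nabla_1F(x^{(\ell)},y,\theta).$$ A weak Jacobian on $\Theta$ of a locally integrable map $f$ with values in a finite-dimensional space $E$ is a locally integrable map $J$ on $\Theta$ with values in the linear maps $T\to E$ such that $\int_\Theta\varphi\,J[v]\,d\theta=-\int_\Theta (D\varphi[v])\,f\,d\theta$ for all $v\in T$ and $\varphi\in C^1_c(\Theta)$. Partial Jacobians $\partial_1,\partial_3$ below are Fréchet derivatives in the first and third argument, and $D_{(v,\delta)}h$ is the two-sided directional derivative of $(x,\theta)\mapsto h(x,y,\theta)$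 (resp. $(a,\theta)\mapsto h(a,y,\theta)$) in the direction $(v,\delta)$. Then for all $\ell\ge0$ and $1\le k\le Q$ the maps $\theta\mapsto a^{(\ell)},x^{(\ell)},z_k^{(\ell)},Z_k^{(\ell)}$ have weak Jacobians on $\Theta$. For any choice $\mathcal J_a^{(\ell)},\mathcal J_x^{(\ell)},\mathcal J_{z_k}^{(\ell)},\mathcal J_{Z_k}^{(\ell)}$ of them and every $\ell\ge 0$, the following holds for Lebesgue-almost every $\theta\in\Theta$ (all derivatives of $\psi$, $\mathrm{Prox}_{\nu QG_k}$ and $\nabla_1F$ being taken at $(a^{(\ell)},y,\theta)$, $(Z_k^{(\ell)},y,\theta)$ and $(x^{(\ell)},y,\theta)$ respectively). 1. $\mathcal J_a^{(\ell)}=(\mathcal J_x^{(\ell)},\mathcal J_{z_1}^{(\ell)},\dots,\mathcal J_{z_Q}^{(\ell)})$, $\ \mathcal J_x^{(\ell)}=\Gamma_a^{(\ell)}\mathcal J_a^{(\ell)}$ with $\Gamma_a^{(\ell)}=D\gamma(a^{(\ell)})$, and $\mathcal J_x^{(\ell+1)}=\frac1Q\sum_{k}\mathcal J_{z_k}^{(\ell+1)}$.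 2. If $\psi(\cdot,y,\cdot)$ is differentiable at $(a^{(\ell)},\theta)$, then $\mathcal J_a^{(\ell+1)}=\Psi_a^{(\ell)}\mathcal J_a^{(\ell)}+\Psi_\theta^{(\ell)}$ with $\Psi_a^{(\ell)}=\partial_1\psi$, $\Psi_\theta^{(\ell)}=\partial_3\psi$. 3. For each $k$, if $\mathrm{Prox}_{\nu QG_k}(\cdot,y,\cdot)$ is differentiable at $(Z_k^{(\ell)},\theta)$, then $$\mathcal J_{z_k}^{(\ell+1)}=\mathcal J_{z_k}^{(\ell)}-\mathcal J_x^{(\ell)}+\mathcal G_{k,x}^{(\ell)}\mathcal J_{Z_k}^{(\ell)}+\mathcal G_{k,\theta}^{(\ell)},\qquad \mathcal G_{k,x}^{(\ell)}=\partial_1\mathrm{Prox}_{\nu QG_k},\quad \mathcal G_{k,\theta}^{(\ell)}=\partial_3\mathrm{Prox}_{\nu QG_k}.$$ 4. If $\nabla_1F(\cdot,y,\cdot)$ is differentiable at $(x^{(\ell)},\theta)$, then for each $k$ $$\mathcal J_{Z_k}^{(\ell)}=2\mathcal J_x^{(\ell)}-\mathcal J_{z_k}^{(\ell)}-\nu\big(\mathcal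 F_x^{(\ell)}\mathcal J_x^{(\ell)}+\mathcal F_\theta^{(\ell)}\big),\qquad \mathcal F_x^{(\ell)}=\partial_1\nabla_1F,\quad \mathcal F_\theta^{(\ell)}=\partial_3\nabla_1F.$$ 5. Without any differentiability of these maps at the iterates, for every $k$ and every $\delta\in T$ the following directional derivatives exist and $$\mathcal J_a^{(\ell+1)}\delta=D_{(\mathcal J_a^{(\ell)}\delta,\,\delta)}\psi,\qquad \mathcal J_{z_k}^{(\ell+1)}\delta=\mathcal J_{z_k}^{(\ell)}\delta-\mathcal J_x^{(\ell)}\delta+D_{(\mathcal J_{Z_k}^{(\ell)}\delta,\,\delta)}\mathrm{Prox}_{\nu QG_k},$$ $$\mathcal J_{Z_k}^{(\ell)}\delta=2\mathcal J_x^{(\ell)}\delta-\mathcal J_{z_k}^{(\ell)}\delta-\nu\,D_{(\mathcal J_x^{(\ell)}\delta,\,\delta)}\nabla_1F .$$ -/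

import Mathlib

open MeasureTheory Filter Topology
open scoped NNReal

namespace GFB

section Weak

variable {T : Type*} [NormedAddCommGroup T] [InnerProductSpace ℝ T] [FiniteDimensional ℝ T]
  [MeasurableSpace T] [BorelSpace T]
variable {E : Type*} [NormedAddCommGroup E] [NormedSpace ℝ E]

/-- `J` is a weak Jacobian of `f` on the open set `Ω`: both are locally integrable on `Ω` and the
integration by parts formula holds in every direction `v` (linearly in `v`, hence for all partial
derivatives) against all `C¹` test functions with compact support in `Ω`. -/
def IsWeakJacobian (Ω : Set T) (f : T → E) (J : T → T →L[ℝ] E) : Prop :=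
  LocallyIntegrableOn f Ω volume ∧ LocallyIntegrableOn J Ω volume ∧
    ∀ φ : T → ℝ, ContDiff ℝ 1 φ → HasCompactSupport φ → tsupport φ ⊆ Ω →
      ∀ v : T, ∫ θ in Ω, φ θ • J θ v = - ∫ θ in Ω, fderiv ℝ φ θ v • f θ

end Weak

section Jacobians

variable {A T B : Type*} [NormedAddCommGroup A] [NormedSpace ℝ A]
  [NormedAddCommGroup T] [NormedSpace ℝ T] [NormedAddCommGroup B] [NormedSpace ℝ B]

/-- Partial Jacobian of `f (a, y, θ)` in its first argument. -/
noncomputable def jac1 {Y : Type*} (f : A → Y → T → B) (a : A) (y : Y) (θ : T) : A →L[ℝ] B :=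
  fderiv ℝ (fun a' => f a' y θ) a

/-- Partial Jacobian of `f (a, y, θ)` in its third argument. -/
noncomputable def jac3 {Y : Type*} (f : A → Y → T → B) (a : A) (y : Y) (θ : T) : T →L[ℝ] B :=
  fderiv ℝ (fun θ' => f a y θ') θ

/-- `f (·, y, ·)` as a function of the pair `(a, θ)`, with `y` frozen. -/
def atObs {Y : Type*} (f : A → Y → T → B) (y : Y) : A × T → B := fun p => f p.1 y p.2

/-- `θ ↦ f (a, θ)` is locally Lipschitz on `Ω`, locally uniformly in `a`. -/
def LocallyLipschitzInParam (Ω : Set T) (f : A → T → B) : Prop :=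
  ∀ a₀ : A, ∀ θ₀ ∈ Ω, ∃ K : ℝ≥0, ∃ U ∈ 𝓝 a₀, ∃ V ∈ 𝓝 θ₀,
    ∀ a ∈ U, LipschitzOnWith K (f a) (V ∩ Ω)

end Jacobians

section Convex

variable {X : Type*} [NormedAddCommGroup X] [InnerProductSpace ℝ X]

/-- Proper, closed (lower semicontinuous) and convex extended-real-valued functions. -/
structure IsProperClosedConvex (g : X → EReal) : Prop where
  ne_bot : ∀ x, g x ≠ ⊥
  exists_ne_top : ∃ x, g x ≠ ⊤
  closed : LowerSemicontinuous g
  convex : Convex ℝ {p : X × ℝ | g p.1 ≤ (p.2 : EReal)}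

/-- `p` minimizes `z ↦ ½‖z - x‖² + g z`. -/
def IsProxPoint (g : X → EReal) (x p : X) : Prop :=
  ∀ z : X, (((1 / 2) * ‖p - x‖ ^ 2 : ℝ) : EReal) + g p ≤
    (((1 / 2) * ‖z - x‖ ^ 2 : ℝ) : EReal) + g z

open Classical in
/-- The proximal mapping of `g`: the minimizer of `z ↦ ½‖z - x‖² + g z`, which exists and is unique
for `g` proper, closed and convex on a Hilbert space (default value `x` if there is none). -/
noncomputable def prox (g : X → EReal) (x : X) : X :=
  if h : ∃ p, IsProxPoint g x p then h.choose else x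

/-- `Prox_{ν Q G_k} (x, y, θ)`. -/
noncomputable def proxG {Y T : Type*} {Q : ℕ} (ν : ℝ) (G : Fin Q → X → Y → T → EReal) (k : Fin Q)
    (x : X) (y : Y) (θ : T) : X :=
  prox (fun z => ((ν * (Q : ℝ) : ℝ) : EReal) * G k z y θ) x

end Convex

section Algorithm

variable {X Y T : Type*} [NormedAddCommGroup X] [InnerProductSpace ℝ X] [CompleteSpace X]
variable {Q : ℕ}

/-- `∇₁F (x, y, θ)`. -/
noncomputable def grad1 (F : X → Y → T → ℝ) (x : X) (y : Y) (θ : T) : X :=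
  gradient (fun x' => F x' y θ) x

/-- `Z_k = 2 x - z_k - ν ∇₁F (x, y, θ)`, as a function of `a = (x, z_1, …, z_Q)`. -/
noncomputable def zarg (F : X → Y → T → ℝ) (ν : ℝ) (k : Fin Q)
    (a : X × (Fin Q → X)) (y : Y) (θ : T) : X :=
  (2 : ℝ) • a.1 - a.2 k - ν • grad1 F a.1 y θ

/-- The update of `z_k`, as a function of `a = (x, z_1, …, z_Q)`. -/
noncomputable def znext (F : X → Y → T → ℝ) (G : Fin Q → X → Y → T → EReal) (ν : ℝ) (k : Fin Q)
    (a : X × (Fin Q → X)) (y : Y) (θ : T) : X :=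
  a.2 k - a.1 + proxG ν G k (zarg F ν k a y θ) y θ

/-- The iteration map `ψ` on `X^{1+Q}`. -/
noncomputable def psi (F : X → Y → T → ℝ) (G : Fin Q → X → Y → T → EReal) (ν : ℝ)
    (a : X × (Fin Q → X)) (y : Y) (θ : T) : X × (Fin Q → X) :=
  ((1 / (Q : ℝ)) • ∑ k, znext F G ν k a y θ, fun k => znext F G ν k a y θ)

/-- The output map `γ (ξ, z_1, …, z_Q) = ξ`. -/
def gam (a : X × (Fin Q → X)) : X := a.1

/-- The iterates `a^{(ℓ)} (y, θ)`, started at `a^{(0)} (y, θ) = a₀ y θ`. -/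
noncomputable def iter (F : X → Y → T → ℝ) (G : Fin Q → X → Y → T → EReal) (ν : ℝ)
    (a₀ : Y → T → X × (Fin Q → X)) : ℕ → Y → T → X × (Fin Q → X)
  | 0, y, θ => a₀ y θ
  | ℓ + 1, y, θ => psi F G ν (iter F G ν a₀ ℓ y θ) y θ

end Algorithm

end GFB

/-! Everything rests on local Lipschitz continuity, which survives composition. A proximal map is
nonexpansive in its base point, so with the assumption on the parameter it is jointly locally
Lipschitz (`locallyLipschitzOn_proxG`). Hence so is `psi`, and by induction every iterate and every
`Z_k` is locally Lipschitz in θ. By Rademacher's theorem, integration by parts and uniqueness of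
weak derivatives, any weak Jacobian of such a map is its Fréchet derivative almost everywhere
(`IsWeakJacobian.ae_hasFDerivAt`).

The difficulty is the chain rule for `h (u θ, θ)`: the graph of `u` may stay inside the null set
where `h` is not differentiable. But here the composite is itself an iterate or a linear combination
of iterates, so it is differentiable almost everywhere regardless. The curve `(u (θ + tδ), θ + tδ)`
and its tangent line differ by `o(t)`, which a Lipschitz `h` cannot distinguish to first order; so
`h` has a directional derivative along the tangent, equal to that of the composite
(`hasLineDerivAt_of_hasFDerivAt_comp`). Where `h` is differentiable, the usual chain rule applies.
-/

namespace GFB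

/-! ### Existence and nonexpansiveness of proximal points -/

section Prox

variable {X : Type*} [NormedAddCommGroup X] [InnerProductSpace ℝ X]

lemma ereal_coe_mul_le_coe_iff {c : ℝ} (hc : 0 < c) (u : EReal) (r : ℝ) :
    (c : EReal) * u ≤ r ↔ u ≤ ((r / c : ℝ) : EReal) := by
  induction u using EReal.rec with
  | bot => simp [EReal.coe_mul_bot_of_pos hc]
  | top =>
    rw [EReal.coe_mul_top_of_pos hc]
    simp only [top_le_iff, EReal.coe_ne_top]
  | coe s =>
    rw [← EReal.coe_mul, EReal.coe_le_coe_iff, EReal.coe_le_coe_iff, le_div_iff₀ hc, mul_comm]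

/-- A positive multiple of a proper, closed and convex function is proper, closed and convex. -/
lemma IsProperClosedConvex.const_mul {g : X → EReal} (hg : IsProperClosedConvex g) {c : ℝ}
    (hc : 0 < c) : IsProperClosedConvex (fun x => (c : EReal) * g x) where
  ne_bot x := by
    have := hg.ne_bot x
    generalize g x = u at this
    induction u using EReal.rec with
    | bot => exact absurd rfl this
    | top => simp [EReal.coe_mul_top_of_pos hc]
    | coe s => rw [← EReal.coe_mul]; exact EReal.coe_ne_bot _
  exists_ne_top := by
    obtain ⟨x, hx⟩ := hg.exists_ne_top
    refine ⟨x, ?_⟩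
    have hb := hg.ne_bot x
    lift g x to ℝ using ⟨hx, hb⟩ with s
    rw [← EReal.coe_mul]
    exact EReal.coe_ne_top _
  closed := by
    -- Extended multiplication can fail to be continuous only at products of zero and infinity,
    -- excluded by `c ≠ 0`.
    have hcont : Continuous fun u : EReal => (c : EReal) * u := by
      refine continuous_iff_continuousAt.2 fun u => ?_
      have hm : ContinuousAt (fun p : EReal × EReal => p.1 * p.2) ((c : EReal), u) := by
        apply EReal.continuousAt_mul <;> simp [hc.ne']
      exact hm.comp (f := fun u : EReal => ((c : EReal), u)) (by fun_prop)
    exact hcont.comp_lowerSemicontinuous hg.closed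
      fun u v huv => mul_le_mul_of_nonneg_left huv (EReal.coe_nonneg.2 hc.le)
  convex := by
    intro p hp q hq a b ha hb hab
    simp only [Set.mem_ofPred_eq, ereal_coe_mul_le_coe_iff hc] at hp hq ⊢
    have := hg.convex (x := (p.1, p.2 / c)) hp (y := (q.1, q.2 / c)) hq ha hb hab
    simp only [Set.mem_ofPred_eq, Prod.fst_add, Prod.smul_fst, Prod.snd_add, Prod.smul_snd,
      smul_eq_mul] at this ⊢
    rwa [add_div, mul_div_assoc, mul_div_assoc]

/-- Convexity inequality along a segment. -/
lemma IsProperClosedConvex.le_segment {g : X → EReal} (hg : IsProperClosedConvex g) {p q : X}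
    {r s t : ℝ} (hp : g p ≤ r) (hq : g q ≤ s) (ht0 : 0 ≤ t) (ht1 : t ≤ 1) :
    g (p + t • (q - p)) ≤ ((r + t * (s - r) : ℝ) : EReal) := by
  have := hg.convex (x := (p, r)) hp (y := (q, s)) hq (sub_nonneg.2 ht1) ht0 (by ring)
  simp only [Set.mem_ofPred_eq, Prod.fst_add, Prod.smul_fst, Prod.snd_add, Prod.smul_snd,
    smul_eq_mul] at this
  convert this using 2
  · module
  · ring

/-- A proper, closed and convex function has a minorant of linear growth. -/
lemma IsProperClosedConvex.exists_linear_minorant [FiniteDimensional ℝ X] {g : X → EReal}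
    (hg : IsProperClosedConvex g) (x₀ : X) {r₀ : ℝ} (hr₀ : g x₀ = r₀) :
    ∃ m c : ℝ, 0 ≤ c ∧ ∀ z, ((m - c * ‖z - x₀‖ : ℝ) : EReal) ≤ g z := by
  -- Let `m` be the minimum of `g` on the unit ball about `x₀`. For `z` outside, convexity on the
  -- segment from `x₀` to `z`, tested where it crosses the unit sphere, bounds the descent rate by
  -- `r₀ - m`.
  obtain ⟨w₀, hw₀, hmin⟩ := LowerSemicontinuousOn.exists_isMinOn
    (s := Metric.closedBall x₀ 1) ⟨x₀, by simp⟩ (isCompact_closedBall x₀ 1)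
    (hg.closed.lowerSemicontinuousOn _)
  have hle : g w₀ ≤ r₀ := hr₀ ▸ hmin (by simp : x₀ ∈ Metric.closedBall x₀ 1)
  have htop : g w₀ ≠ ⊤ := (hle.trans_lt (EReal.coe_lt_top r₀)).ne
  obtain ⟨m, hm⟩ : ∃ m : ℝ, g w₀ = m := ⟨_, (EReal.coe_toReal htop (hg.ne_bot w₀)).symm⟩
  rw [hm, EReal.coe_le_coe_iff] at hle
  refine ⟨m, r₀ - m, by linarith, fun z => ?_⟩
  rcases le_total ‖z - x₀‖ 1 with hz | hz
  · have h1 : g w₀ ≤ g z := hmin (by simpa [dist_eq_norm] using hz : z ∈ Metric.closedBall x₀ 1)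
    rw [hm] at h1
    refine le_trans (EReal.coe_le_coe_iff.2 ?_) h1
    nlinarith [norm_nonneg (z - x₀)]
  · by_cases hzt : g z = ⊤
    · simp [hzt]
    obtain ⟨s, hs⟩ : ∃ s : ℝ, g z = s := ⟨_, (EReal.coe_toReal hzt (hg.ne_bot z)).symm⟩
    have hpos : 0 < ‖z - x₀‖ := by linarith
    have hmem : x₀ + (‖z - x₀‖)⁻¹ • (z - x₀) ∈ Metric.closedBall x₀ 1 := by
      simp [dist_eq_norm, norm_smul, hpos.ne']
    have h1 : g w₀ ≤ _ := hmin hmem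
    have h2 := h1.trans (hg.le_segment hr₀.le hs.le (inv_nonneg.2 hpos.le) (inv_le_one_of_one_le₀ hz))
    rw [hm, EReal.coe_le_coe_iff] at h2
    rw [hs, EReal.coe_le_coe_iff]
    have h3 := mul_le_mul_of_nonneg_left h2 hpos.le
    have h4 : ‖z - x₀‖ * (r₀ + (‖z - x₀‖)⁻¹ * (s - r₀)) = ‖z - x₀‖ * r₀ + (s - r₀) := by
      field_simp
    rw [h4] at h3
    linarith

/-- The proximal problem of a proper, closed and convex function has a solution. -/
lemma IsProperClosedConvex.exists_isProxPoint [FiniteDimensional ℝ X] {g : X → EReal}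
    (hg : IsProperClosedConvex g) (x : X) : ∃ p, IsProxPoint g x p := by
  obtain ⟨x₀, hx₀⟩ := hg.exists_ne_top
  obtain ⟨r₀, hr₀⟩ : ∃ r : ℝ, g x₀ = r := ⟨_, (EReal.coe_toReal hx₀ (hg.ne_bot x₀)).symm⟩
  obtain ⟨m, c, hc, hmc⟩ := hg.exists_linear_minorant x₀ hr₀
  have hm : m ≤ r₀ := by
    have := hmc x₀
    rw [hr₀, EReal.coe_le_coe_iff] at this
    simpa using this
  have hlsc : LowerSemicontinuous fun z => (((1 / 2) * ‖z - x‖ ^ 2 : ℝ) : EReal) + g z := by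
    refine LowerSemicontinuous.add' ?_ hg.closed fun z =>
      EReal.continuousAt_add (Or.inl (EReal.coe_ne_top _)) (Or.inl (EReal.coe_ne_bot _))
    exact (continuous_coe_real_ereal.comp (by fun_prop)).lowerSemicontinuous
  set d := ‖x₀ - x‖ with hd
  have hd0 : 0 ≤ d := norm_nonneg _
  -- Chosen so that outside the ball the quadratic term beats the linear minorant and the objective
  -- is at least its value at `x₀`. The summand `1` makes `‖z - x₀‖ ≥ 1` there, which `h6` uses.
  set R := 2 * (d + c + 1 + (r₀ - m)) with hR
  have hR0 : 0 ≤ R := by linarith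
  obtain ⟨p, -, hp⟩ := LowerSemicontinuousOn.exists_isMinOn
    (s := Metric.closedBall x₀ R) ⟨x₀, by simpa using hR0⟩ (isCompact_closedBall x₀ R)
    (hlsc.lowerSemicontinuousOn _)
  refine ⟨p, fun z => ?_⟩
  by_cases hz : z ∈ Metric.closedBall x₀ R
  · exact hp hz
  · have h0 : _ ≤ (((1 / 2) * ‖x₀ - x‖ ^ 2 : ℝ) : EReal) + g x₀ :=
      hp (by simpa using hR0 : x₀ ∈ Metric.closedBall x₀ R)
    refine h0.trans (le_trans ?_ (add_le_add_right (hmc z) _))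
    rw [hr₀, ← EReal.coe_add, ← EReal.coe_add, EReal.coe_le_coe_iff]
    have hzR : R < ‖z - x₀‖ := by simpa [dist_eq_norm] using hz
    have htri : ‖z - x₀‖ - d ≤ ‖z - x‖ := by
      have := norm_sub_le (z - x) (x₀ - x)
      rw [sub_sub_sub_cancel_right] at this
      linarith
    have hsq : (‖z - x₀‖ - d) ^ 2 ≤ ‖z - x‖ ^ 2 := by
      refine pow_le_pow_left₀ ?_ htri 2
      linarith
    set ρ := ‖z - x₀‖
    have h5 : (d + c + 1 + (r₀ - m)) * ρ ≤ ρ / 2 * ρ := by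
      apply mul_le_mul_of_nonneg_right <;> linarith
    have h6 : (r₀ - m) * 1 ≤ (r₀ - m) * ρ := by
      apply mul_le_mul_of_nonneg_left <;> linarith
    nlinarith

/-- An infinite value would contradict comparison with any point where `g` is finite. This allows
values at proximal points to be treated as reals. -/
lemma IsProxPoint.ne_top {g : X → EReal} (hg : IsProperClosedConvex g) {x p : X}
    (hp : IsProxPoint g x p) : g p ≠ ⊤ := by
  intro h
  obtain ⟨x₀, hx₀⟩ := hg.exists_ne_top
  have h1 := hp x₀
  rw [h, EReal.coe_add_top, top_le_iff] at h1
  exact EReal.add_ne_top (EReal.coe_ne_top _) hx₀ h1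

/-- The variational inequality of the proximal mapping. -/
lemma IsProxPoint.inner_nonneg {g : X → EReal} (hg : IsProperClosedConvex g) {x p q : X}
    (hp : IsProxPoint g x p) {r s : ℝ} (hr : g p = r) (hs : g q = s) :
    0 ≤ inner ℝ (p - x) (q - p) + (s - r) := by
  -- Compare `p` with the point at parameter `t` on the segment to `q` and divide by `t`; the limit
  -- `t → 0⁺` removes the quadratic term.
  have key : ∀ t : ℝ, 0 < t → t ≤ 1 →
      0 ≤ (inner ℝ (p - x) (q - p) + (s - r)) + t * (‖q - p‖ ^ 2 / 2) := by
    intro t ht0 ht1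
    have h1 := (hp (p + t • (q - p))).trans
      (add_le_add_right (hg.le_segment hr.le hs.le ht0.le ht1) _)
    rw [hr, ← EReal.coe_add, ← EReal.coe_add, EReal.coe_le_coe_iff] at h1
    have h2 : ‖p + t • (q - p) - x‖ ^ 2 =
        ‖p - x‖ ^ 2 + 2 * (t * inner ℝ (p - x) (q - p)) + t ^ 2 * ‖q - p‖ ^ 2 := by
      rw [show p + t • (q - p) - x = (p - x) + t • (q - p) by abel, norm_add_sq_real,
        inner_smul_right, norm_smul, mul_pow, Real.norm_eq_abs, sq_abs]
    rw [h2] at h1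
    have h3 : 0 ≤ t * ((inner ℝ (p - x) (q - p) + (s - r)) + t * (‖q - p‖ ^ 2 / 2)) := by
      nlinarith
    exact nonneg_of_mul_nonneg_right h3 ht0
  refine ge_of_tendsto (x := 𝓝[>] (0 : ℝ))
    (f := fun t => (inner ℝ (p - x) (q - p) + (s - r)) + t * (‖q - p‖ ^ 2 / 2)) ?_ ?_
  · refine Tendsto.mono_left ?_ nhdsWithin_le_nhds
    exact Continuous.tendsto' (by fun_prop) _ _ (by simp)
  · filter_upwards [Ioc_mem_nhdsGT (zero_lt_one' ℝ)] with t ht using key t ht.1 ht.2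

/-- Proximal points depend on the base point in a nonexpansive way. -/
lemma IsProxPoint.norm_sub_le {g : X → EReal} (hg : IsProperClosedConvex g) {x x' p p' : X}
    (hp : IsProxPoint g x p) (hp' : IsProxPoint g x' p') : ‖p - p'‖ ≤ ‖x - x'‖ := by
  obtain ⟨r, hr⟩ : ∃ r : ℝ, g p = r := ⟨_, (EReal.coe_toReal (hp.ne_top hg) (hg.ne_bot p)).symm⟩
  obtain ⟨s, hs⟩ : ∃ s : ℝ, g p' = s :=
    ⟨_, (EReal.coe_toReal (hp'.ne_top hg) (hg.ne_bot p')).symm⟩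
  -- In the sum of the two variational inequalities the values of `g` cancel; Cauchy–Schwarz
  -- concludes.
  have h1 := hp.inner_nonneg hg hr hs
  have h2 := hp'.inner_nonneg hg hs hr
  have h3 : inner ℝ (p - x) (p' - p) + inner ℝ (p' - x') (p - p')
      = inner ℝ (x - x') (p - p') - ‖p - p'‖ ^ 2 := by
    rw [← real_inner_self_eq_norm_sq, ← neg_sub p p', inner_neg_right, ← inner_neg_left,
      ← inner_add_left, ← inner_sub_left]
    congr 1
    abel
  have h4 := real_inner_le_norm (x - x') (p - p')
  by_contra! hlt
  nlinarith [norm_nonneg (x - x'), norm_nonneg (p - p')]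

lemma IsProperClosedConvex.isProxPoint_prox [FiniteDimensional ℝ X] {g : X → EReal}
    (hg : IsProperClosedConvex g) (x : X) : IsProxPoint g x (prox g x) := by
  have h := hg.exists_isProxPoint x
  rw [prox, dif_pos h]
  exact h.choose_spec

lemma IsProperClosedConvex.norm_prox_sub_le [FiniteDimensional ℝ X] {g : X → EReal}
    (hg : IsProperClosedConvex g) (x x' : X) : ‖prox g x - prox g x'‖ ≤ ‖x - x'‖ :=
  (hg.isProxPoint_prox x).norm_sub_le hg (hg.isProxPoint_prox x')

end Prox

/-! ### Stability of local Lipschitz continuity -/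

section LocallyLipschitz

variable {α β γ : Type*} [PseudoEMetricSpace α] [PseudoEMetricSpace β] [PseudoEMetricSpace γ]

lemma locallyLipschitzOn_comp {f : α → β} {g : β → γ} {s : Set α} {t : Set β}
    (hg : LocallyLipschitzOn t g) (hf : LocallyLipschitzOn s f) (hst : Set.MapsTo f s t) :
    LocallyLipschitzOn s (fun x => g (f x)) := by
  intro x hx
  obtain ⟨K, u, hu, hfu⟩ := hf hx
  obtain ⟨L, v, hv, hgv⟩ := hg (hst hx)
  have hpre : f ⁻¹' v ∈ 𝓝[s] x :=
    (hf.continuousOn x hx).tendsto_nhdsWithin hst hv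
  exact ⟨L * K, u ∩ f ⁻¹' v, inter_mem hu hpre,
    hgv.comp (hfu.mono Set.inter_subset_left) fun y hy => hy.2⟩

lemma locallyLipschitzOn_prodMk {f : α → β} {g : α → γ} {s : Set α}
    (hf : LocallyLipschitzOn s f) (hg : LocallyLipschitzOn s g) :
    LocallyLipschitzOn s (fun x => (f x, g x)) := by
  intro x hx
  obtain ⟨K, u, hu, hfu⟩ := hf hx
  obtain ⟨L, v, hv, hgv⟩ := hg hx
  exact ⟨max K L, u ∩ v, inter_mem hu hv,
    (hfu.mono Set.inter_subset_left).prodMk (hgv.mono Set.inter_subset_right)⟩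

lemma locallyLipschitzOn_pi {ι : Type*} [Fintype ι] {f : α → ι → β} {s : Set α}
    (hf : ∀ i, LocallyLipschitzOn s (fun x => f x i)) : LocallyLipschitzOn s f := by
  intro x hx
  choose K u hu hfu using fun i => hf i hx
  refine ⟨Finset.univ.sup K, ⋂ i, u i, iInter_mem.2 hu, fun y hy z hz => ?_⟩
  refine (edist_pi_le_iff).2 fun i => ?_
  refine (hfu i (Set.mem_iInter.1 hy i) (Set.mem_iInter.1 hz i)).trans ?_
  gcongr
  exact Finset.le_sup (Finset.mem_univ i)

end LocallyLipschitz

/-! ### Weak Jacobians of locally Lipschitz maps -/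

section Sobolev

variable {T : Type*} [NormedAddCommGroup T] [InnerProductSpace ℝ T] [FiniteDimensional ℝ T]
  [MeasurableSpace T] [BorelSpace T]
variable {E : Type*} [NormedAddCommGroup E] [NormedSpace ℝ E]
variable {Ω : Set T} {f : T → E}

omit [InnerProductSpace ℝ T] [FiniteDimensional ℝ T] [MeasurableSpace T] [BorelSpace T]
  [NormedSpace ℝ E] in
lemma exists_lipschitzOnWith_nhds (hΩ : IsOpen Ω) (hf : LocallyLipschitzOn Ω f) {x : T}
    (hx : x ∈ Ω) : ∃ K, ∃ u, IsOpen u ∧ x ∈ u ∧ u ⊆ Ω ∧ LipschitzOnWith K f u := by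
  obtain ⟨K, u, hu, hfu⟩ := hf hx
  rw [hΩ.nhdsWithin_eq hx] at hu
  obtain ⟨v, hv, hvo, hxv⟩ := mem_nhds_iff.1 (inter_mem hu (hΩ.mem_nhds hx))
  exact ⟨K, v, hvo, hxv, fun y hy => (hv hy).2, hfu.mono fun y hy => (hv hy).1⟩

/-- Rademacher's theorem for locally Lipschitz maps on an open set. -/
lemma ae_differentiableAt_of_locallyLipschitzOn [FiniteDimensional ℝ E] (hΩ : IsOpen Ω)
    (hf : LocallyLipschitzOn Ω f) : ∀ᵐ θ ∂(volume.restrict Ω), DifferentiableAt ℝ f θ := by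
  rw [ae_restrict_iff' hΩ.measurableSet, ae_iff]
  -- A locally null set is null, so Rademacher's theorem is only needed on small neighbourhoods with
  -- a uniform Lipschitz constant.
  refine measure_null_of_locally_null _ fun x hx => ?_
  have hxΩ : x ∈ Ω := by
    by_contra h
    exact hx fun h' => absurd h' h
  obtain ⟨K, u, huo, hxu, -, hfu⟩ := exists_lipschitzOnWith_nhds hΩ hf hxΩ
  refine ⟨_, inter_mem (mem_nhdsWithin_of_mem_nhds (huo.mem_nhds hxu)) self_mem_nhdsWithin, ?_⟩
  refine measure_mono_null ?_ (ae_iff.1 (hfu.ae_differentiableWithinAt_of_mem (μ := volume)))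
  rintro θ ⟨hθu, hθ⟩ h
  exact hθ fun _ => (h hθu).differentiableAt (huo.mem_nhds hθu)

/-- The derivative is measurable and, near each point, bounded by a local Lipschitz constant. -/
lemma locallyIntegrableOn_fderiv [FiniteDimensional ℝ E] (hΩ : IsOpen Ω)
    (hf : LocallyLipschitzOn Ω f) : LocallyIntegrableOn (fderiv ℝ f) Ω volume := by
  intro x hx
  have : CompleteSpace E := FiniteDimensional.complete ℝ E
  have : ProperSpace (T →L[ℝ] E) := FiniteDimensional.proper_real _
  obtain ⟨K, u, huo, hxu, -, hfu⟩ := exists_lipschitzOnWith_nhds hΩ hf hx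
  obtain ⟨ε, hε, hball⟩ := Metric.isOpen_iff.1 huo x hxu
  refine ⟨Metric.ball x ε, mem_nhdsWithin_of_mem_nhds (Metric.ball_mem_nhds x hε), ?_⟩
  borelize (T →L[ℝ] E)
  refine Measure.integrableOn_of_bounded (M := K) measure_ball_lt_top.ne
    (measurable_fderiv ℝ f).aestronglyMeasurable ?_
  filter_upwards [ae_restrict_mem measurableSet_ball] with θ hθ
  exact norm_fderiv_le_of_lipschitzOn ℝ (huo.mem_nhds (hball hθ)) hfu

/-- The product lives on a compact subset of `Ω`, where `w` is integrable and `φ` bounded. It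
justifies splitting the integrals in the weak formulation and moving functionals through them. -/
lemma integrableOn_smul_of_tsupport_subset {w : T → E} (hΩ : IsOpen Ω)
    (hw : LocallyIntegrableOn w Ω volume) {φ : T → ℝ} (hφ : Continuous φ)
    (hφc : HasCompactSupport φ) (hφs : tsupport φ ⊆ Ω) :
    IntegrableOn (fun θ => φ θ • w θ) Ω volume := by
  have h1 : IntegrableOn (fun θ => φ θ • w θ) (tsupport φ) volume :=
    (hw.integrableOn_compact_subset hφs hφc).continuousOn_smul hφ.continuousOn hφc
  exact h1.of_forall_sdiff_eq_zero hΩ.measurableSet fun θ hθ => by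
    rw [image_eq_zero_of_notMem_tsupport hθ.2, zero_smul]

/-- The derivative of a locally Lipschitz map is a weak Jacobian. -/
lemma isWeakJacobian_fderiv [FiniteDimensional ℝ E] (hΩ : IsOpen Ω)
    (hf : LocallyLipschitzOn Ω f) : IsWeakJacobian Ω f (fderiv ℝ f) := by
  have hfi : LocallyIntegrableOn f Ω volume :=
    hf.continuousOn.locallyIntegrableOn hΩ.measurableSet
  have hJi := locallyIntegrableOn_fderiv hΩ hf
  refine ⟨hfi, hJi, fun φ hφ hφc hφs v => ?_⟩
  have : CompleteSpace E := FiniteDimensional.complete ℝ E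
  have hJv : LocallyIntegrableOn (fun θ => fderiv ℝ f θ v) Ω volume := fun x hx => by
    obtain ⟨u, hu, hi⟩ := hJi x hx
    exact ⟨u, hu, (ContinuousLinearMap.apply ℝ E v).integrable_comp hi⟩
  have hI1 := integrableOn_smul_of_tsupport_subset hΩ hJv hφ.continuous hφc hφs
  have hφ' : Continuous fun θ => fderiv ℝ φ θ v :=
    (hφ.continuous_fderiv one_ne_zero).clm_apply continuous_const
  have hφs' : tsupport (fun θ => fderiv ℝ φ θ v) ⊆ tsupport φ :=
    tsupport_fderiv_apply_subset ℝ v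
  have hφc' : HasCompactSupport fun θ => fderiv ℝ φ θ v :=
    hφc.mono' (subset_closure.trans hφs')
  have hI2 := integrableOn_smul_of_tsupport_subset hΩ hfi hφ' hφc' (hφs'.trans hφs)
  -- Testing with functionals reduces to scalar functions, for which Lipschitz extension is
  -- available.
  refine (SeparatingDual.eq_iff_forall_dual_eq (R := ℝ)).2 fun L => ?_
  rw [map_neg, ← L.integral_comp_comm hI1, ← L.integral_comp_comm hI2]
  -- On a compact `K'` whose interior contains the support of `φ`, `L ∘ f` is Lipschitz and extends
  -- to a globally Lipschitz `g`. Integration by parts on all of `T` applies to `g`, which agrees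
  -- with `L ∘ f` near every point of the support, so the derivatives there agree too.
  obtain ⟨K', hK'c, hKK', hK'Ω⟩ := exists_compact_between hφc hΩ hφs
  obtain ⟨C, hC⟩ := (hf.mono hK'Ω).exists_lipschitzOnWith_of_compact hK'c
  obtain ⟨g, hg, hfg⟩ := (L.lipschitz.comp_lipschitzOnWith hC).extend_real
  obtain ⟨D, hD⟩ := hφ.lipschitzWith_of_hasCompactSupport hφc one_ne_zero
  have hparts := hg.integral_lineDeriv_mul_eq (μ := volume) hD hφc v
  have hdiff := (ae_restrict_iff' hΩ.measurableSet).1 (ae_differentiableAt_of_locallyLipschitzOn hΩ hf)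
  have hL : ∫ θ in Ω, L (φ θ • fderiv ℝ f θ v) = ∫ θ, lineDeriv ℝ g θ v * φ θ := by
    rw [setIntegral_eq_integral_of_forall_compl_eq_zero]
    · refine integral_congr_ae ?_
      filter_upwards [hdiff] with θ hθ
      by_cases hθφ : θ ∈ tsupport φ
      · have hnh : K' ∈ 𝓝 θ := mem_interior_iff_mem_nhds.1 (hKK' hθφ)
        have hev : g =ᶠ[𝓝 θ] L ∘ f := by
          filter_upwards [hnh] with y hy using (hfg hy).symm
        have hd := hθ (hφs hθφ)
        have hgd : HasFDerivAt g (L ∘L fderiv ℝ f θ) θ :=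
          (L.hasFDerivAt.comp θ hd.hasFDerivAt).congr_of_eventuallyEq hev
        rw [(hgd.hasLineDerivAt v).lineDeriv, map_smul, smul_eq_mul, mul_comm]
        rfl
      · simp [image_eq_zero_of_notMem_tsupport hθφ]
    · intro θ hθ
      rw [image_eq_zero_of_notMem_tsupport fun h => hθ (hφs h), zero_smul, map_zero]
  have hR : ∫ θ in Ω, L (fderiv ℝ φ θ v • f θ) = ∫ θ, fderiv ℝ φ θ v * g θ := by
    rw [setIntegral_eq_integral_of_forall_compl_eq_zero]
    · congr 1
      ext θ
      by_cases hθφ : θ ∈ tsupport φ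
      · rw [map_smul, smul_eq_mul]
        exact congrArg _ (hfg (interior_subset (hKK' hθφ)))
      · have h0 : fderiv ℝ φ θ v = 0 :=
          image_eq_zero_of_notMem_tsupport (f := fun θ => fderiv ℝ φ θ v) fun h => hθφ (hφs' h)
        simp [h0]
    · intro θ hθ
      have h0 : fderiv ℝ φ θ v = 0 :=
        image_eq_zero_of_notMem_tsupport (f := fun θ => fderiv ℝ φ θ v)
          fun h => hθ (hφs (hφs' h))
      rw [h0, zero_smul, map_zero]
  rw [hL, hR, hparts, ← integral_neg]
  congr 1
  ext θ
  rw [((hφ.differentiable one_ne_zero) θ).lineDeriv_eq_fderiv, map_neg, neg_mul]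

lemma IsWeakJacobian.locallyIntegrableOn_apply [CompleteSpace E] {J : T → T →L[ℝ] E}
    (hJ : IsWeakJacobian Ω f J) (v : T) :
    LocallyIntegrableOn (fun θ => J θ v) Ω volume := fun x hx => by
  obtain ⟨u, hu, hi⟩ := hJ.2.1 x hx
  exact ⟨u, hu, (ContinuousLinearMap.apply ℝ E v).integrable_comp hi⟩

/-- Weak Jacobians are unique almost everywhere. -/
lemma IsWeakJacobian.ae_eq [CompleteSpace E] (hΩ : IsOpen Ω) {J J' : T → T →L[ℝ] E}
    (hJ : IsWeakJacobian Ω f J) (hJ' : IsWeakJacobian Ω f J') :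
    ∀ᵐ θ ∂(volume.restrict Ω), J θ = J' θ := by
  have hv : ∀ v : T, ∀ᵐ θ ∂(volume.restrict Ω), J θ v - J' θ v = 0 := by
    intro v
    have h1 := hJ.locallyIntegrableOn_apply v
    have h2 := hJ'.locallyIntegrableOn_apply v
    rw [ae_restrict_iff' hΩ.measurableSet]
    -- Fundamental lemma of the calculus of variations.
    refine hΩ.ae_eq_zero_of_integral_contDiff_smul_eq_zero (f := fun θ => J θ v - J' θ v)
      (h1.sub h2) fun φ hφ hφc hφs => ?_
    have hφ1 : ContDiff ℝ 1 φ := hφ.of_le (by exact_mod_cast le_top)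
    rw [← setIntegral_eq_integral_of_forall_compl_eq_zero (s := Ω) fun θ hθ => by
      rw [image_eq_zero_of_notMem_tsupport fun h => hθ (hφs h), zero_smul]]
    simp only [smul_sub]
    rw [integral_sub (integrableOn_smul_of_tsupport_subset hΩ h1 hφ.continuous hφc hφs)
      (integrableOn_smul_of_tsupport_subset hΩ h2 hφ.continuous hφc hφs),
      hJ.2.2 φ hφ1 hφc hφs v, hJ'.2.2 φ hφ1 hφc hφs v, sub_self]
  -- The null set depends on `v`; a finite basis yields a single one for all directions.
  have hb := ae_all_iff.2 fun i => hv (Module.finBasis ℝ T i)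
  filter_upwards [hb] with θ hθ
  exact ContinuousLinearMap.coe_injective
    ((Module.finBasis ℝ T).ext fun i => sub_eq_zero.1 (hθ i))

/-- A weak Jacobian of a locally Lipschitz map is its derivative almost everywhere. -/
lemma IsWeakJacobian.ae_hasFDerivAt [FiniteDimensional ℝ E] (hΩ : IsOpen Ω)
    (hf : LocallyLipschitzOn Ω f) {J : T → T →L[ℝ] E} (hJ : IsWeakJacobian Ω f J) :
    ∀ᵐ θ ∂(volume.restrict Ω), HasFDerivAt f (J θ) θ := by
  have : CompleteSpace E := FiniteDimensional.complete ℝ E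
  filter_upwards [hJ.ae_eq hΩ (isWeakJacobian_fderiv hΩ hf),
    ae_differentiableAt_of_locallyLipschitzOn hΩ hf] with θ h1 h2
  rw [h1]
  exact h2.hasFDerivAt

end Sobolev

/-! ### Chain rules along a differentiable curve of parameters -/

section Chain

variable {A T B : Type*} [NormedAddCommGroup A] [NormedSpace ℝ A]
  [NormedAddCommGroup T] [NormedSpace ℝ T] [NormedAddCommGroup B] [NormedSpace ℝ B]

/-- If `h` is locally Lipschitz and both `u` and `θ ↦ h (u θ, θ)` are differentiable at `θ`, then
`h` has directional derivatives at `(u θ, θ)` in the directions `(u' δ, δ)`. -/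
lemma hasLineDerivAt_of_hasFDerivAt_comp {Ω : Set T} (hΩ : IsOpen Ω) {h : A × T → B}
    (hh : LocallyLipschitzOn (Set.univ ×ˢ Ω) h) {u : T → A} {u' : T →L[ℝ] A} {θ : T}
    (hθ : θ ∈ Ω) (hu : HasFDerivAt u u' θ) {w' : T →L[ℝ] B}
    (hw : HasFDerivAt (fun θ => h (u θ, θ)) w' θ) (δ : T) :
    HasLineDerivAt ℝ h (w' δ) (u θ, θ) (u' δ, δ) := by
  have hmem : (u θ, θ) ∈ (Set.univ : Set A) ×ˢ Ω := ⟨trivial, hθ⟩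
  obtain ⟨K, s, hs, hKs⟩ := hh hmem
  rw [(isOpen_univ.prod hΩ).nhdsWithin_eq hmem] at hs
  have hul := (hu.hasLineDerivAt δ : HasDerivAt (fun t : ℝ => u (θ + t • δ)) _ _)
  have hwl := (hw.hasLineDerivAt δ :
    HasDerivAt (fun t : ℝ => h (u (θ + t • δ), θ + t • δ)) _ _)
  rw [HasLineDerivAt]
  have hc1 : Tendsto (fun t : ℝ => (u (θ + t • δ), θ + t • δ)) (𝓝 0) (𝓝 (u θ, θ)) := by
    refine Tendsto.prodMk_nhds ?_ (Continuous.tendsto' (by fun_prop) _ _ (by simp))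
    simpa using hul.continuousAt.tendsto
  have hc2 : Tendsto (fun t : ℝ => (u θ, θ) + t • (u' δ, δ)) (𝓝 0) (𝓝 (u θ, θ)) :=
    Continuous.tendsto' (by fun_prop) _ _ (by simp)
  have hlin : HasDerivAt (fun t : ℝ => u θ + t • u' δ) (u' δ) 0 := by
    simpa using ((hasDerivAt_id (0 : ℝ)).smul_const (u' δ)).const_add (u θ)
  have hdiff : HasDerivAt (fun t : ℝ => (u θ + t • u' δ) - u (θ + t • δ)) 0 0 := by
    simpa using hlin.fun_sub hul
  -- Both paths have the same second coordinate `θ + t • δ`, so the Lipschitz bound involves only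
  -- the gap `hdiff` in the first, which is `o(t)`.
  have hrem : HasDerivAt (fun t : ℝ => h ((u θ, θ) + t • (u' δ, δ))
      - h (u (θ + t • δ), θ + t • δ)) 0 0 := by
    rw [hasDerivAt_iff_isLittleO] at hdiff ⊢
    refine Asymptotics.IsBigO.trans_isLittleO ?_ hdiff
    refine Asymptotics.IsBigO.of_bound K ?_
    filter_upwards [hc1 hs, hc2 hs] with t ht1 ht2
    have := hKs.norm_sub_le ht2 ht1
    simpa [Prod.norm_def] using this
  have hsum := hrem.fun_add hwl
  simpa using hsum

/-- The chain rule for `θ ↦ h (u θ, θ)`. -/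
lemma eq_jac_of_hasFDerivAt_comp {Y : Type*} {h : A → Y → T → B} {y : Y} {u : T → A}
    {u' : T →L[ℝ] A} {θ : T} (hu : HasFDerivAt u u' θ) {w' : T →L[ℝ] B}
    (hw : HasFDerivAt (fun θ => h (u θ) y θ) w' θ)
    (hd : DifferentiableAt ℝ (atObs h y) (u θ, θ)) :
    w' = (jac1 h (u θ) y θ) ∘L u' + jac3 h (u θ) y θ := by
  set H := fderiv ℝ (atObs h y) (u θ, θ) with hH
  have hd' : HasFDerivAt (atObs h y) H (u θ, θ) := hd.hasFDerivAt
  have h1 : HasFDerivAt (fun a => h a y θ) (H ∘L ContinuousLinearMap.inl ℝ A T) (u θ) :=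
    HasFDerivAt.comp (g := atObs h y) (f := fun a => (a, θ)) (u θ) hd' (hasFDerivAt_prodMk_left (u θ) θ)
  have h3 : HasFDerivAt (fun θ' => h (u θ) y θ') (H ∘L ContinuousLinearMap.inr ℝ A T) θ :=
    HasFDerivAt.comp (g := atObs h y) θ hd' (hasFDerivAt_prodMk_right (u θ) θ)
  have hc : HasFDerivAt (fun θ => h (u θ) y θ)
      (H ∘L u'.prod (ContinuousLinearMap.id ℝ T)) θ :=
    HasFDerivAt.comp (g := atObs h y) (f := fun θ => (u θ, θ)) θ hd' (hu.prodMk (hasFDerivAt_id θ))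
  rw [hw.unique hc, jac1, jac3, h1.fderiv, h3.fderiv]
  ext δ
  simp [← map_add]

end Chain

/-! ### Local Lipschitz continuity of the GFB iterates -/

section Algorithm

variable {X Y T : Type*} [NormedAddCommGroup X] [InnerProductSpace ℝ X] [FiniteDimensional ℝ X]
  [CompleteSpace X] [NormedAddCommGroup T] [InnerProductSpace ℝ T]
  {Ω : Set T} {y : Y} {Q : ℕ} {ν : ℝ} {F : X → Y → T → ℝ} {G : Fin Q → X → Y → T → EReal}

lemma locallyLipschitzOn_contDiff_comp {α E E' : Type*} [PseudoEMetricSpace α]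
    [NormedAddCommGroup E] [NormedSpace ℝ E] [NormedAddCommGroup E'] [NormedSpace ℝ E']
    {L : E → E'} (hL : ContDiff ℝ 1 L) {s : Set α} {f : α → E} (hf : LocallyLipschitzOn s f) :
    LocallyLipschitzOn s (fun x => L (f x)) :=
  locallyLipschitzOn_comp (t := Set.univ) (locallyLipschitzOn_univ.2 hL.locallyLipschitz) hf
    (Set.mapsTo_univ f s)

omit [CompleteSpace X] [InnerProductSpace ℝ T] in
/-- The proximal mappings are jointly locally Lipschitz in the point and the parameter. -/
lemma locallyLipschitzOn_proxG (hQ : 0 < Q) (hν : 0 < ν) {k : Fin Q}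
    (hG : ∀ θ ∈ Ω, IsProperClosedConvex (fun x => G k x y θ))
    (hGlip : LocallyLipschitzInParam Ω (fun x θ => proxG ν G k x y θ)) :
    LocallyLipschitzOn (Set.univ ×ˢ Ω) (atObs (proxG ν G k) y) := by
  rintro ⟨a₀, θ₀⟩ ⟨-, hθ₀⟩
  obtain ⟨K, U, hU, V, hV, hK⟩ := hGlip a₀ θ₀ hθ₀
  refine ⟨1 + K, U ×ˢ (V ∩ Ω), ?_, ?_⟩
  · rw [nhdsWithin_prod_eq, nhdsWithin_univ]
    exact prod_mem_prod hU (inter_mem (mem_nhdsWithin_of_mem_nhds hV) self_mem_nhdsWithin)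
  · refine LipschitzOnWith.of_dist_le_mul ?_
    rintro ⟨a, θ⟩ ⟨ha, hθ⟩ ⟨a', θ'⟩ ⟨ha', hθ'⟩
    have hc : (0 : ℝ) < ν * Q := mul_pos hν (Nat.cast_pos.2 hQ)
    have h1 : dist (proxG ν G k a y θ) (proxG ν G k a' y θ) ≤ dist a a' := by
      rw [dist_eq_norm, dist_eq_norm]
      exact ((hG θ hθ.2).const_mul hc).norm_prox_sub_le a a'
    have h2 := (hK a' ha').dist_le_mul θ hθ θ' hθ'
    have h3 : dist a a' ≤ dist (a, θ) (a', θ') := le_max_left _ _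
    have h4 : dist θ θ' ≤ dist (a, θ) (a', θ') := le_max_right _ _
    -- Move the point first at fixed `θ`, with constant 1 by nonexpansiveness, then the parameter at
    -- fixed `a'`, with constant `K`.
    calc dist (proxG ν G k a y θ) (proxG ν G k a' y θ')
        ≤ dist a a' + K * dist θ θ' := (dist_triangle _ _ _).trans (add_le_add h1 h2)
      _ ≤ (1 + K) * dist (a, θ) (a', θ') := by
        rw [add_mul, one_mul]
        gcongr

omit [FiniteDimensional ℝ X] in
lemma locallyLipschitzOn_zarg
    (hF : LocallyLipschitzOn (Set.univ ×ˢ Ω) (atObs (grad1 F) y)) (k : Fin Q) :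
    LocallyLipschitzOn (Set.univ ×ˢ Ω) (atObs (zarg F ν k) y) := by
  have hid : LocallyLipschitzOn ((Set.univ : Set (X × (Fin Q → X))) ×ˢ Ω) id :=
    LocallyLipschitz.id.locallyLipschitzOn
  have hg := locallyLipschitzOn_comp (s := (Set.univ : Set (X × (Fin Q → X))) ×ˢ Ω) hF
    (locallyLipschitzOn_contDiff_comp
      (L := fun p : (X × (Fin Q → X)) × T => (p.1.1, p.2)) (by fun_prop) hid)
    fun p hp => ⟨trivial, hp.2⟩
  exact locallyLipschitzOn_contDiff_comp
    (L := fun p : ((X × (Fin Q → X)) × T) × X => (2 : ℝ) • p.1.1.1 - p.1.1.2 k - ν • p.2)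
    (by fun_prop) (locallyLipschitzOn_prodMk hid hg)

omit [FiniteDimensional ℝ X] in
lemma locallyLipschitzOn_psi
    (hF : LocallyLipschitzOn (Set.univ ×ˢ Ω) (atObs (grad1 F) y))
    (hP : ∀ k, LocallyLipschitzOn (Set.univ ×ˢ Ω) (atObs (proxG ν G k) y)) :
    LocallyLipschitzOn (Set.univ ×ˢ Ω) (atObs (psi F G ν) y) := by
  have hid : LocallyLipschitzOn ((Set.univ : Set (X × (Fin Q → X))) ×ˢ Ω) id :=
    LocallyLipschitz.id.locallyLipschitzOn
  have hsnd : LocallyLipschitzOn ((Set.univ : Set (X × (Fin Q → X))) ×ˢ Ω) Prod.snd :=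
    LipschitzWith.prod_snd.locallyLipschitz.locallyLipschitzOn
  have hz : ∀ k, LocallyLipschitzOn ((Set.univ : Set (X × (Fin Q → X))) ×ˢ Ω)
      (atObs (znext F G ν k) y) := by
    intro k
    have hp := locallyLipschitzOn_comp (hP k)
      (locallyLipschitzOn_prodMk (locallyLipschitzOn_zarg (ν := ν) hF k) hsnd)
      fun p hp => ⟨trivial, hp.2⟩
    exact locallyLipschitzOn_contDiff_comp
      (L := fun p : ((X × (Fin Q → X)) × T) × X => p.1.1.2 k - p.1.1.1 + p.2)
      (by fun_prop) (locallyLipschitzOn_prodMk hid hp)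
  exact locallyLipschitzOn_contDiff_comp
    (L := fun z : Fin Q → X => ((1 / (Q : ℝ)) • ∑ k, z k, z)) (by fun_prop)
    (locallyLipschitzOn_pi hz)

omit [FiniteDimensional ℝ X] in
lemma locallyLipschitzOn_iter
    (hF : LocallyLipschitzOn (Set.univ ×ˢ Ω) (atObs (grad1 F) y))
    (hP : ∀ k, LocallyLipschitzOn (Set.univ ×ˢ Ω) (atObs (proxG ν G k) y))
    {a₀ : Y → T → X × (Fin Q → X)} (ha₀ : LocallyLipschitzOn Ω (a₀ y)) (ℓ : ℕ) :
    LocallyLipschitzOn Ω (fun θ => iter F G ν a₀ ℓ y θ) := by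
  induction ℓ with
  | zero => exact ha₀
  | succ ℓ ih =>
    exact locallyLipschitzOn_comp (f := fun θ => (iter F G ν a₀ ℓ y θ, θ))
      (locallyLipschitzOn_psi hF hP)
      (locallyLipschitzOn_prodMk ih LocallyLipschitz.id.locallyLipschitzOn)
      fun θ hθ => ⟨trivial, hθ⟩

end Algorithm

end GFB

/-! ### The recursion for the weak Jacobians -/

theorem mainTheorem9
    {X : Type*} [NormedAddCommGroup X] [InnerProductSpace ℝ X] [FiniteDimensional ℝ X]
    [CompleteSpace X]
    {Y : Type*} [NormedAddCommGroup Y] [InnerProductSpace ℝ Y] [FiniteDimensional ℝ Y]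
    {T : Type*} [NormedAddCommGroup T] [InnerProductSpace ℝ T] [FiniteDimensional ℝ T]
    [MeasurableSpace T] [BorelSpace T]
    (Ω : Set T) (hΩ : IsOpen Ω) (y : Y)
    (Q : ℕ) (hQ : 0 < Q) (ν : ℝ) (hν : 0 < ν)
    (F : X → Y → T → ℝ) (G : Fin Q → X → Y → T → EReal)
    (a₀ : Y → T → X × (Fin Q → X))
    (hF : ∀ θ ∈ Ω, ContDiff ℝ 1 (fun x => F x y θ))
    (hFlip : LocallyLipschitzOn (Set.univ ×ˢ Ω) (GFB.atObs (GFB.grad1 F) y))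
    (hG : ∀ k, ∀ θ ∈ Ω, GFB.IsProperClosedConvex (fun x => G k x y θ))
    (hGlip : ∀ k, GFB.LocallyLipschitzInParam Ω (fun x θ => GFB.proxG ν G k x y θ))
    (ha₀ : LocallyLipschitzOn Ω (a₀ y)) :
    -- the iterates and the points `Z_k` are weakly differentiable in `θ`
    (∀ ℓ : ℕ,
      (∃ J, GFB.IsWeakJacobian Ω (fun θ => GFB.iter F G ν a₀ ℓ y θ) J) ∧
      (∃ J, GFB.IsWeakJacobian Ω (fun θ => GFB.gam (GFB.iter F G ν a₀ ℓ y θ)) J) ∧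
      (∀ k, ∃ J, GFB.IsWeakJacobian Ω (fun θ => (GFB.iter F G ν a₀ ℓ y θ).2 k) J) ∧
      (∀ k, ∃ J, GFB.IsWeakJacobian Ω
        (fun θ => GFB.zarg F ν k (GFB.iter F G ν a₀ ℓ y θ) y θ) J)) ∧
    -- and all their weak Jacobians obey the recursion
    (∀ (Ja : ℕ → T → T →L[ℝ] X × (Fin Q → X)) (Jx : ℕ → T → T →L[ℝ] X)
      (Jz JZ : ℕ → Fin Q → T → T →L[ℝ] X),
      (∀ ℓ, GFB.IsWeakJacobian Ω (fun θ => GFB.iter F G ν a₀ ℓ y θ) (Ja ℓ)) →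
      (∀ ℓ, GFB.IsWeakJacobian Ω (fun θ => GFB.gam (GFB.iter F G ν a₀ ℓ y θ)) (Jx ℓ)) →
      (∀ ℓ k, GFB.IsWeakJacobian Ω (fun θ => (GFB.iter F G ν a₀ ℓ y θ).2 k) (Jz ℓ k)) →
      (∀ ℓ k, GFB.IsWeakJacobian Ω
        (fun θ => GFB.zarg F ν k (GFB.iter F G ν a₀ ℓ y θ) y θ) (JZ ℓ k)) →
      ∀ ℓ : ℕ, ∀ᵐ θ ∂(volume.restrict Ω),
        ∀ (a : X × (Fin Q → X)) (x : X) (Z : Fin Q → X),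
        a = GFB.iter F G ν a₀ ℓ y θ → x = GFB.gam a → (∀ k, Z k = GFB.zarg F ν k a y θ) →
        -- `J_a = (J_x, J_{z_1}, …, J_{z_Q})` and `J_x = Γ_a (J_a)`
        (∀ δ, Ja ℓ θ δ = (Jx ℓ θ δ, fun k => Jz ℓ k θ δ)) ∧
        Jx ℓ θ = (fderiv ℝ (GFB.gam (X := X) (Q := Q)) a) ∘L (Ja ℓ θ) ∧
        -- `J_a⁺ = Ψ_a (J_a) + Ψ_θ`
        (∀ δ, LineDifferentiableAt ℝ (GFB.atObs (GFB.psi F G ν) y) (a, θ) (Ja ℓ θ δ, δ) ∧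
          Ja (ℓ + 1) θ δ =
            lineDeriv ℝ (GFB.atObs (GFB.psi F G ν) y) (a, θ) (Ja ℓ θ δ, δ)) ∧
        (DifferentiableAt ℝ (GFB.atObs (GFB.psi F G ν) y) (a, θ) →
          Ja (ℓ + 1) θ = (GFB.jac1 (GFB.psi F G ν) a y θ) ∘L (Ja ℓ θ)
            + GFB.jac3 (GFB.psi F G ν) a y θ) ∧
        -- `J_x⁺ = (1/Q) ∑ J_{z_k}⁺`
        Jx (ℓ + 1) θ = (1 / (Q : ℝ)) • ∑ k, Jz (ℓ + 1) k θ ∧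
        ∀ k,
          -- `J_{z_k}⁺ = J_{z_k} - J_x + G_{k,x} (J_{Z_k}) + G_{k,θ}`
          (∀ δ, LineDifferentiableAt ℝ (GFB.atObs (GFB.proxG ν G k) y) (Z k, θ)
              (JZ ℓ k θ δ, δ) ∧
            Jz (ℓ + 1) k θ δ = Jz ℓ k θ δ - Jx ℓ θ δ +
              lineDeriv ℝ (GFB.atObs (GFB.proxG ν G k) y) (Z k, θ) (JZ ℓ k θ δ, δ)) ∧
          (DifferentiableAt ℝ (GFB.atObs (GFB.proxG ν G k) y) (Z k, θ) →
            Jz (ℓ + 1) k θ = Jz ℓ k θ - Jx ℓ θ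
              + (GFB.jac1 (GFB.proxG ν G k) (Z k) y θ) ∘L (JZ ℓ k θ)
              + GFB.jac3 (GFB.proxG ν G k) (Z k) y θ) ∧
          -- `J_{Z_k} = 2 J_x - J_{z_k} - ν (F_x (J_x) + F_θ)`
          (∀ δ, LineDifferentiableAt ℝ (GFB.atObs (GFB.grad1 F) y) (x, θ) (Jx ℓ θ δ, δ) ∧
            JZ ℓ k θ δ = (2 : ℝ) • Jx ℓ θ δ - Jz ℓ k θ δ -
              ν • lineDeriv ℝ (GFB.atObs (GFB.grad1 F) y) (x, θ) (Jx ℓ θ δ, δ)) ∧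
          (DifferentiableAt ℝ (GFB.atObs (GFB.grad1 F) y) (x, θ) →
            JZ ℓ k θ = (2 : ℝ) • Jx ℓ θ - Jz ℓ k θ
              - ν • ((GFB.jac1 (GFB.grad1 F) x y θ) ∘L (Jx ℓ θ)
                + GFB.jac3 (GFB.grad1 F) x y θ))) := by
  have hP := fun k => GFB.locallyLipschitzOn_proxG hQ hν (hG k) (hGlip k)
  have hψ := GFB.locallyLipschitzOn_psi hFlip hP
  have hlip := GFB.locallyLipschitzOn_iter hFlip hP ha₀
  have hlipx : ∀ ℓ, LocallyLipschitzOn Ω (fun θ => GFB.gam (GFB.iter F G ν a₀ ℓ y θ)) := fun ℓ =>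
    GFB.locallyLipschitzOn_contDiff_comp (L := fun a : X × (Fin Q → X) => a.1) (by fun_prop) (hlip ℓ)
  have hlipz : ∀ ℓ k, LocallyLipschitzOn Ω (fun θ => (GFB.iter F G ν a₀ ℓ y θ).2 k) := fun ℓ k =>
    GFB.locallyLipschitzOn_contDiff_comp (L := fun a : X × (Fin Q → X) => a.2 k) (by fun_prop)
      (hlip ℓ)
  have hlipZ : ∀ ℓ k, LocallyLipschitzOn Ω
      (fun θ => GFB.zarg F ν k (GFB.iter F G ν a₀ ℓ y θ) y θ) := fun ℓ k =>
    GFB.locallyLipschitzOn_comp (GFB.locallyLipschitzOn_zarg hFlip k)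
      (GFB.locallyLipschitzOn_prodMk (hlip ℓ) LocallyLipschitz.id.locallyLipschitzOn)
      fun θ hθ => ⟨trivial, hθ⟩
  refine ⟨fun ℓ => ⟨⟨_, GFB.isWeakJacobian_fderiv hΩ (hlip ℓ)⟩,
    ⟨_, GFB.isWeakJacobian_fderiv hΩ (hlipx ℓ)⟩,
    fun k => ⟨_, GFB.isWeakJacobian_fderiv hΩ (hlipz ℓ k)⟩,
    fun k => ⟨_, GFB.isWeakJacobian_fderiv hΩ (hlipZ ℓ k)⟩⟩, ?_⟩
  intro Ja Jx Jz JZ hJa hJx hJz hJZ ℓ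
  -- Outside one null set, depending on `ℓ`, all the weak Jacobians involved are genuine Fréchet
  -- derivatives; the rest is pointwise calculus at `θ`.
  filter_upwards [ae_restrict_mem hΩ.measurableSet, (hJa ℓ).ae_hasFDerivAt hΩ (hlip ℓ),
    (hJa (ℓ + 1)).ae_hasFDerivAt hΩ (hlip (ℓ + 1)), (hJx ℓ).ae_hasFDerivAt hΩ (hlipx ℓ),
    (hJx (ℓ + 1)).ae_hasFDerivAt hΩ (hlipx (ℓ + 1)),
    ae_all_iff.2 fun k => (hJz ℓ k).ae_hasFDerivAt hΩ (hlipz ℓ k),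
    ae_all_iff.2 fun k => (hJz (ℓ + 1) k).ae_hasFDerivAt hΩ (hlipz (ℓ + 1) k),
    ae_all_iff.2 fun k => (hJZ ℓ k).ae_hasFDerivAt hΩ (hlipZ ℓ k)]
    with θ hθ da da' dx dx' dz dz' dZ
  intro a x Z ha hx hZ
  obtain rfl : Z = fun k => GFB.zarg F ν k a y θ := funext hZ
  subst hx ha
  -- Solving the update of `z_k` for the proximal term expresses it through iterates already known
  -- to be differentiable at `θ`, so no differentiability of the proximal map is needed.
  have dP : ∀ k, HasFDerivAt
      (fun θ => GFB.proxG ν G k (GFB.zarg F ν k (GFB.iter F G ν a₀ ℓ y θ) y θ) y θ)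
      (Jz (ℓ + 1) k θ - Jz ℓ k θ + Jx ℓ θ) θ := by
    intro k
    convert (((dz' k).fun_sub (dz k)).fun_add dx) using 2 with θ'
    simp only [GFB.iter, GFB.psi, GFB.znext, GFB.gam]
    abel
  -- Likewise the definition of `Z_k` is solved for the gradient, using `ν ≠ 0`.
  have dF : ∀ k, HasFDerivAt
      (fun θ => GFB.grad1 F (GFB.gam (GFB.iter F G ν a₀ ℓ y θ)) y θ)
      (ν⁻¹ • ((2 : ℝ) • Jx ℓ θ - Jz ℓ k θ - JZ ℓ k θ)) θ := by
    intro k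
    convert ((((dx.fun_const_smul (2 : ℝ)).fun_sub (dz k)).fun_sub (dZ k)).fun_const_smul ν⁻¹)
      using 2 with θ'
    rw [eq_inv_smul_iff₀ hν.ne']
    simp only [GFB.zarg, GFB.gam]
    abel
  refine ⟨?_, ?_, fun δ => ?_, fun hd => ?_, ?_, fun k => ⟨fun δ => ?_, fun hd => ?_, fun δ => ?_,
    fun hd => ?_⟩⟩
  · intro δ
    have e1 := dx.unique (hasFDerivAt_fst.comp θ da)
    have e2 := fun k => (dz k).unique
      (((ContinuousLinearMap.proj (R := ℝ) (φ := fun _ : Fin Q => X) k).comp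
        (ContinuousLinearMap.snd ℝ X (Fin Q → X))).hasFDerivAt.comp θ da)
    simp only [e1, e2]
    rfl
  · have e : fderiv ℝ (GFB.gam (X := X) (Q := Q)) (GFB.iter F G ν a₀ ℓ y θ) =
        ContinuousLinearMap.fst ℝ X (Fin Q → X) := hasFDerivAt_fst.fderiv
    rw [e]
    exact dx.unique (hasFDerivAt_fst.comp θ da)
  · have h := GFB.hasLineDerivAt_of_hasFDerivAt_comp hΩ hψ hθ da (w' := Ja (ℓ + 1) θ) da' δ
    exact ⟨h.lineDifferentiableAt, h.lineDeriv.symm⟩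
  · exact GFB.eq_jac_of_hasFDerivAt_comp (h := GFB.psi F G ν) da da' hd
  · refine dx'.unique ?_
    exact (HasFDerivAt.fun_sum fun k _ => dz' k).fun_const_smul (1 / (Q : ℝ))
  · have h := GFB.hasLineDerivAt_of_hasFDerivAt_comp hΩ (hP k) hθ (dZ k) (dP k) δ
    refine ⟨h.lineDifferentiableAt, ?_⟩
    rw [h.lineDeriv]
    simp
  · have h := GFB.eq_jac_of_hasFDerivAt_comp (h := GFB.proxG ν G k) (dZ k) (dP k) hd
    rw [add_assoc, ← h]
    abel
  · have h := GFB.hasLineDerivAt_of_hasFDerivAt_comp hΩ hFlip hθ dx (dF k) δ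
    refine ⟨h.lineDifferentiableAt, ?_⟩
    rw [h.lineDeriv, smul_apply, smul_inv_smul₀ hν.ne']
    simp
  · have h := GFB.eq_jac_of_hasFDerivAt_comp (h := GFB.grad1 F) dx (dF k) hd
    rw [← h, smul_inv_smul₀ hν.ne']
    abel
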